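/- Let $k$ be a local field of characteristic zero, i.e. $k=\mathbb{R}$, $k=\mathbb{C}$, or $k$ is a finite extension of $\mathbb{Q}_p$ for some prime $p$, with its usual topology. Let $n\geq 3$ be an odd integer, and regard $\mathrm{SL}_{n-1}(k)$ as the subgroup of $\mathrm{SL}_n(k)$ obtained by placing $(n-1)\times(n-1)$ matrices in the upper left corner, with $1$ in the lower right corner and $0$ elsewhere. Let $\Gamma$ be a discrete subgroup of $\mathrm{SL}_n(k)$ whose action by left translation on $\mathrm{SL}_n(k)/\mathrm{SL}_{n-1}(k)$ is properly discontinuous, i.e. for all compact subsets $K,L$ of $\mathrm{SL}_n(k)/\mathrm{SL}_{n-1}(k)$ the set $\{\gamma\in\Gamma : \gamma K\cap L\neq\emptyset\}$ is finite. Then $\Gamma$ is virtually abelian, and in fact virtually cyclic; that is, $\Gamma$ has an abelian subgroup of finite index, and it even has a cyclic subgroup of finite index. -/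

import Mathlib

/-- A local field of characteristic zero: a topological field which is (isomorphic, as a
topological field, to) `ℝ` or `ℂ`, or a finite extension of some `ℚ_[p]` with its canonical
topology, i.e. the topology of a finite-dimensional `ℚ_[p]`-vector space. -/
def IsCharZeroLocalField (k : Type*) [Field k] [TopologicalSpace k] : Prop :=
  (∃ e : ℝ ≃+* k, IsHomeomorph e) ∨
  (∃ e : ℂ ≃+* k, IsHomeomorph e) ∨
  (∃ (p : ℕ) (_ : Fact p.Prime) (_ : Algebra ℚ_[p] k),
    FiniteDimensional ℚ_[p] k ∧ IsModuleTopology ℚ_[p] k)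

/-- The embedding `SL_m → SL_{m+1}` placing an `m × m` matrix in the upper left corner,
with `1` in the remaining diagonal entry and `0` elsewhere. -/
def slCornerHom (m : ℕ) (R : Type*) [CommRing R] :
    Matrix.SpecialLinearGroup (Fin m) R →* Matrix.SpecialLinearGroup (Fin (m + 1)) R where
  toFun A := ⟨Matrix.reindex finSumFinEquiv finSumFinEquiv
    (Matrix.fromBlocks A.1 0 0 (1 : Matrix (Fin 1) (Fin 1) R)), by
      rw [Matrix.det_reindex_self, Matrix.det_fromBlocks_zero₂₁, A.2, Matrix.det_one, one_mul]⟩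
  map_one' := by
    apply Subtype.ext
    simp
  map_mul' A B := by
    apply Subtype.ext
    change Matrix.reindex finSumFinEquiv finSumFinEquiv (Matrix.fromBlocks (A.1 * B.1) 0 0 1) =
      Matrix.reindex finSumFinEquiv finSumFinEquiv (Matrix.fromBlocks A.1 0 0 1) *
        Matrix.reindex finSumFinEquiv finSumFinEquiv (Matrix.fromBlocks B.1 0 0 1)
    simp [Matrix.submatrix_mul_equiv, Matrix.fromBlocks_multiply]

/-- `SL_m(R)` as a subgroup of `SL_{m+1}(R)`. -/
def slCorner (m : ℕ) (R : Type*) [CommRing R] :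
    Subgroup (Matrix.SpecialLinearGroup (Fin (m + 1)) R) :=
  (slCornerHom m R).range

/-- A group is virtually abelian if it has an abelian subgroup of finite index. -/
def IsVirtuallyAbelian (Γ : Type*) [Group Γ] : Prop :=
  ∃ A : Subgroup Γ, A.FiniteIndex ∧ ∀ x ∈ A, ∀ y ∈ A, x * y = y * x

/-- A group is virtually cyclic if it has a cyclic subgroup of finite index. -/
def IsVirtuallyCyclic (Γ : Type*) [Group Γ] : Prop :=
  ∃ C : Subgroup Γ, C.FiniteIndex ∧ IsCyclic C

/-! Put n = m + 1 and write γ = P D Q with D diagonal and P, Q and their inverses bounded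
independently of γ. If some |d_i| is neither large nor small, moving that coordinate to the last
place gives bounded x, y with y⁻¹γx in SL_{n-1}; proper discontinuity allows this for only finitely
many γ. For the others, n being odd, more than half of the |d_i| are large or more than half are
small, so γ or γ⁻¹ expands on a subspace of dimension > n/2 (`finite_not_expandsOnHalf`). Two such
subspaces meet, so both cannot expand. Thus Γ carries a coarse total order, like ℤ, and any element
of infinite order generates a subgroup of finite index (`finiteIndex_zpowers_of_coarse_order`).

If Γ is torsion, its traces are sums of roots of unity, hence bounded. A finitely generated subgroup
spanning the same matrix algebra is finite by Burnside–Schur (`finite_of_isTorsion_of_fg`), and its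
nondegenerate trace form recovers matrix entries linearly from traces. So Γ is bounded
(`exists_bound_of_isTorsion`), and proper discontinuity makes it finite. -/

/-- A coarse notion of positivity `Big` on a group, which is compatible with translations,
antisymmetric, and total up to finite sets, forces every element of infinite order to generate
a subgroup of finite index. -/
theorem finiteIndex_zpowers_of_coarse_order {G : Type*} [Group G] (Big : ℝ → G → Prop)
    (c : G → ℝ) (hc : ∀ g, 1 ≤ c g)
    (mono : ∀ R R' g, R ≤ R' → Big R' g → Big R g)
    (mul_left : ∀ R g h, 0 ≤ R → Big R g → Big (R / c h) (h * g))
    (mul_right : ∀ R g h, 0 ≤ R → Big R g → Big (R / c h) (g * h))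
    (antisymm : ∀ R g, 1 < R → Big R g → ¬ Big R g⁻¹)
    (total : ∀ R, {g | ¬ Big R g ∧ ¬ Big R g⁻¹}.Finite)
    (γ : G) (hγ : ¬ IsOfFinOrder γ) : (Subgroup.zpowers γ).FiniteIndex := by
  obtain ⟨C, hC1, hCγ, hCγ'⟩ : ∃ C : ℝ, 1 < C ∧ c γ < C ∧ c γ⁻¹ < C :=
    ⟨c γ + c γ⁻¹, by linarith [hc γ, hc γ⁻¹], by linarith [hc γ⁻¹], by linarith [hc γ]⟩
  have hC0 : 0 < C := by linarith
  have hc0 : ∀ g, 0 < c g := fun g => by linarith [hc g]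
  have hinj : Function.Injective (fun n : ℤ => γ ^ n) :=
    injective_zpow_iff_not_isOfFinOrder.2 hγ
  -- The sign cannot flip between neighbours: `g * h` is still `Big` at level `C / c h > 1`, which
  -- excludes its inverse.
  have step : ∀ g h, c h < C → Big C g → (Big C (g * h) ∨ Big C (g * h)⁻¹) → Big C (g * h) := by
    rintro g a ha hg (h | h)
    · exact h
    · have h1 : 1 < C / c a := by rw [lt_div_iff₀ (hc0 _)]; linarith
      refine absurd (mono _ _ _ ?_ h) (antisymm _ _ h1 (mul_right _ _ a hC0.le hg))
      exact div_le_self hC0.le (hc a)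
  -- Every coset of `⟨γ⟩` meets the finite set of elements of no sign. Otherwise the sign is
  -- constant along `g * γ ^ n`, while `γ ^ n` and `γ ^ (-n)` must differ in sign for large `n`.
  have meets : ∀ g : G, ∃ n : ℤ, ¬ Big C (g * γ ^ n) ∧ ¬ Big C (g * γ ^ n)⁻¹ := by
    intro g
    by_contra! hcon
    have hcon' : ∀ n : ℤ, Big C (g * γ ^ n) ∨ Big C (g * γ ^ n)⁻¹ := fun n => by
      by_cases h : Big C (g * γ ^ n)
      · exact Or.inl h
      · exact Or.inr (hcon n h)
    have const : ∀ n : ℤ, Big C (g * γ ^ n) → ∀ m : ℤ, Big C (g * γ ^ m) := by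
      intro n hn m
      induction m using Int.inductionOn' (b := n) with
      | zero => exact hn
      | succ k _ ih =>
        rw [zpow_add_one, ← mul_assoc]
        exact step _ _ hCγ ih (by rw [mul_assoc, ← zpow_add_one]; exact hcon' _)
      | pred k _ ih =>
        rw [zpow_sub_one, ← mul_assoc]
        exact step _ _ hCγ' ih (by rw [mul_assoc, ← zpow_sub_one]; exact hcon' _)
    -- Large enough that translating by `g` or `g⁻¹` leaves at least `C`.
    set D := C * (c g * c g⁻¹) with hD
    have hD0 : 0 ≤ D := by
      have := hc0 g; have := hc0 g⁻¹; positivity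
    have key : ∀ n : ℤ, ¬ Big D (γ ^ n) := by
      intro n hn
      have hle : C ≤ D / c g := by
        rw [le_div_iff₀ (hc0 _), hD]
        have : c g ≤ c g * c g⁻¹ := le_mul_of_one_le_right (hc0 g).le (hc _)
        gcongr
      have hle' : C ≤ D / c g⁻¹ := by
        rw [le_div_iff₀ (hc0 _), hD]
        have : c g⁻¹ ≤ c g * c g⁻¹ := le_mul_of_one_le_left (hc0 _).le (hc _)
        gcongr
      have h1 := const _ (mono _ _ _ hle (mul_left _ _ g hD0 hn)) (-n)
      have h2 := mono _ _ _ hle' (mul_right _ _ g⁻¹ hD0 hn)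
      exact antisymm _ _ hC1 h1 (by simpa [mul_inv_rev] using h2)
    refine Set.infinite_univ (((total D).preimage hinj.injOn).subset fun n _ => ⟨key n, ?_⟩)
    rw [← zpow_neg]
    exact key _
  have : Finite (G ⧸ Subgroup.zpowers γ) := by
    refine Set.finite_univ_iff.1 (((total C).image QuotientGroup.mk).subset fun x _ => ?_)
    obtain ⟨g, rfl⟩ := QuotientGroup.mk_surjective x
    obtain ⟨n, hn⟩ := meets g
    exact ⟨_, hn, QuotientGroup.mk_mul_of_mem _ ⟨n, rfl⟩⟩
  exact Subgroup.finiteIndex_of_finite_quotient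

/-! ### Expansion on more than half the dimension -/

section Expansion

variable {k ι : Type*} [NormedField k] [Fintype ι]

/-- `M` expands by a factor at least `R` (in sup norm) on a subspace of more than half the
dimension. -/
def ExpandsOnHalf (R : ℝ) (M : Matrix ι ι k) : Prop :=
  ∃ V : Submodule k (ι → k), Fintype.card ι < 2 * Module.finrank k V ∧
    ∀ v ∈ V, R * ‖v‖ ≤ ‖M.mulVec v‖

theorem ExpandsOnHalf.mono {R R' : ℝ} {M : Matrix ι ι k} (h : ExpandsOnHalf R' M) (hR : R ≤ R') :
    ExpandsOnHalf R M := by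
  obtain ⟨V, h1, h2⟩ := h
  exact ⟨V, h1, fun v hv => le_trans (by gcongr) (h2 v hv)⟩

theorem norm_mulVec_le_of_entries {M : Matrix ι ι k} {c : ℝ} (hM : ∀ i j, ‖M i j‖ ≤ c)
    (v : ι → k) : ‖M.mulVec v‖ ≤ Fintype.card ι * c * ‖v‖ := by
  rcases isEmpty_or_nonempty ι with h | ⟨⟨i₀⟩⟩
  · simp [Subsingleton.elim v 0]
  have hc : 0 ≤ c := (norm_nonneg _).trans (hM i₀ i₀)
  rw [pi_norm_le_iff_of_nonneg (by positivity)]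
  intro i
  calc ‖∑ j, M i j * v j‖ ≤ ∑ j, ‖M i j * v j‖ := norm_sum_le _ _
    _ ≤ ∑ _j : ι, c * ‖v‖ := Finset.sum_le_sum fun j _ => by
        rw [norm_mul]; exact mul_le_mul (hM i j) (norm_le_pi_norm v j) (norm_nonneg _) hc
    _ = _ := by simp [mul_assoc]

variable [DecidableEq ι]

theorem le_norm_mulVec_of_inverse {M N : Matrix ι ι k} {c : ℝ} (hc : 0 < c) (h : N * M = 1)
    (hN : ∀ v, ‖N.mulVec v‖ ≤ c * ‖v‖) (v : ι → k) : ‖v‖ / c ≤ ‖M.mulVec v‖ := by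
  have := hN (M.mulVec v)
  rw [Matrix.mulVec_mulVec, h, Matrix.one_mulVec] at this
  rwa [div_le_iff₀' hc]

theorem ExpandsOnHalf.mul_left {R c : ℝ} {M N N' : Matrix ι ι k} (h : ExpandsOnHalf R M)
    (hc : 0 < c) (hN : N' * N = 1) (hN' : ∀ v, ‖N'.mulVec v‖ ≤ c * ‖v‖) :
    ExpandsOnHalf (R / c) (N * M) := by
  obtain ⟨V, h1, h2⟩ := h
  refine ⟨V, h1, fun v hv => ?_⟩
  rw [← Matrix.mulVec_mulVec]
  refine le_trans ?_ (le_norm_mulVec_of_inverse hc hN hN' _)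
  rw [div_mul_eq_mul_div]
  gcongr
  exact h2 v hv

theorem ExpandsOnHalf.mul_right {R c : ℝ} {M N N' : Matrix ι ι k} (h : ExpandsOnHalf R M)
    (hR : 0 ≤ R) (hc : 0 < c) (hN : N * N' = 1) (hN' : ∀ v, ‖N'.mulVec v‖ ≤ c * ‖v‖) :
    ExpandsOnHalf (R / c) (M * N) := by
  obtain ⟨V, h1, h2⟩ := h
  have hinj : Function.Injective (Matrix.mulVecLin N') := by
    refine Function.LeftInverse.injective (g := N.mulVec) fun v => ?_
    simp [Matrix.mulVec_mulVec, hN]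
  refine ⟨V.map (Matrix.mulVecLin N'), ?_, ?_⟩
  · rwa [← (Submodule.equivMapOfInjective _ hinj V).finrank_eq]
  · rintro _ ⟨v, hv, rfl⟩
    have e : (M * N).mulVec (N'.mulVec v) = M.mulVec v := by
      rw [Matrix.mulVec_mulVec, mul_assoc, hN, mul_one]
    rw [Matrix.mulVecLin_apply, e]
    refine le_trans ?_ (h2 v hv)
    rw [div_mul_eq_mul_div, div_le_iff₀ hc, mul_assoc, mul_comm ‖v‖]
    exact mul_le_mul_of_nonneg_left (hN' v) hR

/-- By dimension count `M V` meets `W` in some `M v ≠ 0`; going from `v` to `M v` and back would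
multiply the norm by at least `R ^ 2 > 1`. -/
theorem ExpandsOnHalf.not_inverse {R : ℝ} {M N : Matrix ι ι k} (h : ExpandsOnHalf R M)
    (hR : 1 < R) (hN : N * M = 1) : ¬ ExpandsOnHalf R N := by
  rintro ⟨W, hW, hW'⟩
  obtain ⟨V, hV, hV'⟩ := h
  have hinj : Function.Injective (Matrix.mulVecLin M) := by
    refine Function.LeftInverse.injective (g := N.mulVec) fun v => ?_
    simp [Matrix.mulVec_mulVec, hN]
  have hne : V.map (Matrix.mulVecLin M) ⊓ W ≠ ⊥ := by
    intro hbot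
    have h1 := Submodule.finrank_sup_add_finrank_inf_eq (V.map (Matrix.mulVecLin M)) W
    rw [hbot, finrank_bot, ← (Submodule.equivMapOfInjective _ hinj V).finrank_eq] at h1
    have h2 := Submodule.finrank_le (V.map (Matrix.mulVecLin M) ⊔ W)
    rw [Module.finrank_fintype_fun_eq_card] at h2
    omega
  obtain ⟨w, ⟨⟨v, hv, rfl⟩, hw⟩, hw0⟩ := Submodule.exists_mem_ne_zero_of_ne_bot hne
  rw [Matrix.mulVecLin_apply] at hw hw0
  have h1 := hV' v hv
  have h2 := hW' _ hw
  rw [Matrix.mulVec_mulVec, hN, Matrix.one_mulVec] at h2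
  have h3 : 0 < ‖M.mulVec v‖ := norm_pos_iff.2 hw0
  nlinarith [norm_nonneg v]

end Expansion

/-! ### A Cartan-type decomposition by elimination with complete pivoting -/

section BoundedDiagonalization

variable (k : Type*) [NormedField k]

/-- Matrices over `k` indexed by `ι` can be diagonalized on both sides by matrices which, together
with their inverses, have entries bounded by a constant that does not depend on the matrix. -/
def HasBoundedDiagonalization (ι : Type*) [Fintype ι] [DecidableEq ι] : Prop :=
  ∃ C : ℝ, 1 ≤ C ∧ ∀ M : Matrix ι ι k, ∃ (P P' Q Q' : Matrix ι ι k) (d : ι → k),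
    M = P * Matrix.diagonal d * Q ∧ P * P' = 1 ∧ Q * Q' = 1 ∧
    (∀ i j, ‖P i j‖ ≤ C) ∧ (∀ i j, ‖P' i j‖ ≤ C) ∧ (∀ i j, ‖Q i j‖ ≤ C) ∧ ∀ i j, ‖Q' i j‖ ≤ C

variable {k}

theorem norm_mul_apply_le {ι : Type*} [Fintype ι] {A B : Matrix ι ι k} {a b : ℝ} (ha : 0 ≤ a)
    (hA : ∀ i j, ‖A i j‖ ≤ a) (hB : ∀ i j, ‖B i j‖ ≤ b) (i j : ι) :
    ‖(A * B) i j‖ ≤ Fintype.card ι * (a * b) := by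
  rw [Matrix.mul_apply]
  calc ‖∑ l, A i l * B l j‖ ≤ ∑ l, ‖A i l * B l j‖ := norm_sum_le _ _
    _ ≤ ∑ _l : ι, a * b := Finset.sum_le_sum fun l _ => by
        rw [norm_mul]; exact mul_le_mul (hA i l) (hB l j) (norm_nonneg _) ha
    _ = _ := by simp

theorem HasBoundedDiagonalization.of_equiv {ι κ : Type*} [Fintype ι] [DecidableEq ι] [Fintype κ]
    [DecidableEq κ] (e : ι ≃ κ) (h : HasBoundedDiagonalization k ι) :
    HasBoundedDiagonalization k κ := by
  obtain ⟨C, hC, h⟩ := h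
  refine ⟨C, hC, fun M => ?_⟩
  obtain ⟨P, P', Q, Q', d, hM, hP, hQ, h1, h2, h3, h4⟩ := h (M.submatrix e e)
  refine ⟨P.submatrix e.symm e.symm, P'.submatrix e.symm e.symm, Q.submatrix e.symm e.symm,
    Q'.submatrix e.symm e.symm, d ∘ e.symm, ?_, ?_, ?_, fun _ _ => h1 _ _, fun _ _ => h2 _ _,
    fun _ _ => h3 _ _, fun _ _ => h4 _ _⟩
  · rw [← Matrix.submatrix_diagonal_equiv, Matrix.submatrix_mul_equiv, Matrix.submatrix_mul_equiv,
      ← hM]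
    simp
  · rw [Matrix.submatrix_mul_equiv, hP, Matrix.submatrix_one_equiv]
  · rw [Matrix.submatrix_mul_equiv, hQ, Matrix.submatrix_one_equiv]

/-- With a pivot of maximal norm, all elimination multipliers have norm at most 1, so clearing its
row and column costs bounded factors; the Schur complement is handled by `h`. -/
theorem exists_diagonalization_of_pivot {ι : Type*} [Fintype ι] [DecidableEq ι] {C : ℝ}
    (hC : 1 ≤ C)
    (h : ∀ M : Matrix ι ι k, ∃ (P P' Q Q' : Matrix ι ι k) (d : ι → k),
      M = P * Matrix.diagonal d * Q ∧ P * P' = 1 ∧ Q * Q' = 1 ∧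
      (∀ i j, ‖P i j‖ ≤ C) ∧ (∀ i j, ‖P' i j‖ ≤ C) ∧ (∀ i j, ‖Q i j‖ ≤ C) ∧ ∀ i j, ‖Q' i j‖ ≤ C)
    (M : Matrix (ι ⊕ Unit) (ι ⊕ Unit) k)
    (hM : ∀ i j, ‖M i j‖ ≤ ‖M (Sum.inr ()) (Sum.inr ())‖) :
    ∃ (P P' Q Q' : Matrix (ι ⊕ Unit) (ι ⊕ Unit) k) (d : ι ⊕ Unit → k),
      M = P * Matrix.diagonal d * Q ∧ P * P' = 1 ∧ Q * Q' = 1 ∧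
      (∀ i j, ‖P i j‖ ≤ Fintype.card (ι ⊕ Unit) * (1 * C)) ∧
      (∀ i j, ‖P' i j‖ ≤ Fintype.card (ι ⊕ Unit) * (C * 1)) ∧
      (∀ i j, ‖Q i j‖ ≤ Fintype.card (ι ⊕ Unit) * (C * 1)) ∧
      ∀ i j, ‖Q' i j‖ ≤ Fintype.card (ι ⊕ Unit) * (1 * C) := by
  set a := M (Sum.inr ()) (Sum.inr ()) with ha
  let b : Matrix ι Unit k := Matrix.of fun i _ => a⁻¹ * M (Sum.inl i) (Sum.inr ())
  let c : Matrix Unit ι k := Matrix.of fun _ j => a⁻¹ * M (Sum.inr ()) (Sum.inl j)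
  have hb : ∀ i j, ‖b i j‖ ≤ 1 := fun i _ => by
    change ‖a⁻¹ * M _ _‖ ≤ 1
    rw [norm_mul, norm_inv]
    exact inv_mul_le_one_of_le₀ (hM _ _) (norm_nonneg _)
  have hc : ∀ i j, ‖c i j‖ ≤ 1 := fun _ j => by
    change ‖a⁻¹ * M _ _‖ ≤ 1
    rw [norm_mul, norm_inv]
    exact inv_mul_le_one_of_le₀ (hM _ _) (norm_nonneg _)
  -- A zero pivot is harmless: it forces `M = 0`.
  have hcancel : ∀ i j, a * (a⁻¹ * M i j) = M i j := fun i j => by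
    by_cases h0 : a = 0
    · have := hM i j
      rw [h0, norm_zero, norm_le_zero_iff] at this
      simp [this]
    · rw [mul_inv_cancel_left₀ h0]
  obtain ⟨P, P', Q, Q', d, hA, hP, hQ, h1, h2, h3, h4⟩ := h (M.toBlocks₁₁ - a • (b * c))
  have bound : ∀ (u : Matrix ι Unit k) (v : Matrix Unit ι k), (∀ i j, ‖u i j‖ ≤ 1) →
      (∀ i j, ‖v i j‖ ≤ 1) → ∀ i j, ‖Matrix.fromBlocks 1 u v 1 i j‖ ≤ 1 := by
    intro u v hu hv i j
    rcases i with i | i <;> rcases j with j | j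
    · by_cases hij : i = j <;> simp [hij]
    · exact hu _ _
    · exact hv _ _
    · simp
  have bound' : ∀ A : Matrix ι ι k, (∀ i j, ‖A i j‖ ≤ C) →
      ∀ i j, ‖Matrix.fromBlocks A 0 0 (1 : Matrix Unit Unit k) i j‖ ≤ C := by
    intro A hA' i j
    rcases i with i | i <;> rcases j with j | j
    · exact hA' _ _
    · simp; linarith
    · simp; linarith
    · simpa using hC
  have h01 : ∀ i j, ‖(0 : Matrix ι Unit k) i j‖ ≤ 1 := by simp
  have h01' : ∀ i j, ‖(0 : Matrix Unit ι k) i j‖ ≤ 1 := by simp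
  have hC0 : 0 ≤ C := by linarith
  refine ⟨Matrix.fromBlocks 1 b 0 1 * Matrix.fromBlocks P 0 0 1,
    Matrix.fromBlocks P' 0 0 1 * Matrix.fromBlocks 1 (-b) 0 1,
    Matrix.fromBlocks Q 0 0 1 * Matrix.fromBlocks 1 0 c 1,
    Matrix.fromBlocks 1 0 (-c) 1 * Matrix.fromBlocks Q' 0 0 1,
    Sum.elim d (fun _ => a), ?_, ?_, ?_, ?_, ?_, ?_, ?_⟩
  · have hb' : a • b = M.toBlocks₁₂ := by
      ext i j; exact hcancel _ _
    have hc' : a • c = M.toBlocks₂₁ := by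
      ext i j; exact hcancel _ _
    have ha' : Matrix.diagonal (fun _ : Unit => a) = a • 1 := by
      rw [Matrix.smul_one_eq_diagonal]
    have ha'' : a • (1 : Matrix Unit Unit k) = M.toBlocks₂₂ := by
      ext i j; simp [Matrix.toBlocks₂₂, ha]
    rw [← Matrix.fromBlocks_diagonal, ha']
    simp only [Matrix.fromBlocks_multiply, Matrix.one_mul, Matrix.mul_zero, add_zero,
      Matrix.zero_mul, Matrix.mul_one, zero_add, Matrix.mul_smul, Matrix.smul_mul]
    rw [← hA, hb', hc', ha'', sub_add_cancel, Matrix.fromBlocks_toBlocks]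
  · simp [Matrix.fromBlocks_multiply, hP, ← Matrix.mul_assoc]
  · simp [Matrix.fromBlocks_multiply, hQ]
  · exact norm_mul_apply_le zero_le_one (bound _ _ hb h01') (bound' _ h1)
  · exact norm_mul_apply_le hC0 (bound' _ h2) (bound _ _ (by simpa using hb) h01')
  · exact norm_mul_apply_le hC0 (bound' _ h3) (bound _ _ h01 hc)
  · exact norm_mul_apply_le zero_le_one (bound _ _ h01 (by simpa using hc)) (bound' _ h4)

theorem HasBoundedDiagonalization.sum_unit {ι : Type*} [Fintype ι] [DecidableEq ι]
    (h : HasBoundedDiagonalization k ι) : HasBoundedDiagonalization k (ι ⊕ Unit) := by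
  obtain ⟨C, hC, h⟩ := h
  have h1 : (1 : ℝ) ≤ Fintype.card (ι ⊕ Unit) := by simp
  refine ⟨Fintype.card (ι ⊕ Unit) * C, by nlinarith, fun M => ?_⟩
  obtain ⟨⟨p, q⟩, hpq⟩ := Finite.exists_max fun x : (ι ⊕ Unit) × (ι ⊕ Unit) => ‖M x.1 x.2‖
  let σ := Equiv.swap (Sum.inr ()) p
  let τ := Equiv.swap (Sum.inr ()) q
  obtain ⟨P, P', Q, Q', d, hM, hP, hQ, b1, b2, b3, b4⟩ :=
    exists_diagonalization_of_pivot hC h (M.submatrix σ τ) fun i j => by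
      simpa [σ, τ] using hpq (σ i, τ j)
  rw [one_mul] at b1 b4
  rw [mul_one] at b2 b3
  refine ⟨P.submatrix σ id, P'.submatrix id σ, Q.submatrix id τ, Q'.submatrix τ id, d, ?_, ?_, ?_,
    fun _ _ => b1 _ _, fun _ _ => b2 _ _, fun _ _ => b3 _ _, fun _ _ => b4 _ _⟩
  · have : M = (M.submatrix σ τ).submatrix σ τ := by
      ext i j; simp [σ, τ]
    rw [this, hM]
    rfl
  · change (P * P').submatrix σ σ = 1
    rw [hP, Matrix.submatrix_one_equiv]
  · have : Q.submatrix id τ * Q'.submatrix τ id = (Q * Q').submatrix id id := by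
      rw [Matrix.submatrix_mul_equiv]
    rw [this, hQ, Matrix.submatrix_id_id]

theorem hasBoundedDiagonalization_fin (n : ℕ) : HasBoundedDiagonalization k (Fin n) := by
  induction n with
  | zero =>
    exact ⟨1, le_rfl, fun M => ⟨1, 1, 1, 1, 0, Subsingleton.elim _ _, Subsingleton.elim _ _,
      Subsingleton.elim _ _, fun i => i.elim0, fun i => i.elim0, fun i => i.elim0,
      fun i => i.elim0⟩⟩
  | succ n ih =>
    exact ih.sum_unit.of_equiv ((Equiv.sumCongr (Equiv.refl _) finOneEquiv.symm).trans
      finSumFinEquiv)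

end BoundedDiagonalization

/-! ### Consequences of proper discontinuity -/

section ProperAction

theorem mem_slCorner_of_diagonal {m : ℕ} {R : Type*} [CommRing R]
    {h : Matrix.SpecialLinearGroup (Fin (m + 1)) R} {f : Fin (m + 1) → R}
    (hf : h.1 = Matrix.diagonal f) (hlast : f (Fin.last m) = 1) : h ∈ slCorner m R := by
  have hdet := h.2
  rw [hf, Matrix.det_diagonal, Fin.prod_univ_castSucc, hlast, mul_one] at hdet
  refine ⟨⟨Matrix.diagonal fun i => f i.castSucc, by rw [Matrix.det_diagonal, hdet]⟩, ?_⟩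
  apply Subtype.ext
  rw [hf]
  change Matrix.reindex finSumFinEquiv finSumFinEquiv (Matrix.fromBlocks (Matrix.diagonal _) 0 0 1)
    = _
  rw [← Matrix.diagonal_one, Matrix.fromBlocks_diagonal, Matrix.reindex_apply,
    Matrix.submatrix_diagonal_equiv]
  congr 1
  ext i
  refine Fin.lastCases ?_ (fun i => ?_) i
  · simp [hlast]
  · simp

variable {k : Type*} [NormedField k]

theorem expandsOnHalf_diagonal {ι : Type*} [Fintype ι] [DecidableEq ι] {S : ℝ} (hS : 0 ≤ S)
    {d : ι → k} (I : Finset ι) (hI : Fintype.card ι < 2 * I.card) (hd : ∀ i ∈ I, S ≤ ‖d i‖) :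
    ExpandsOnHalf S (Matrix.diagonal d) := by
  refine ⟨⨅ i ∈ ((↑I : Set ι)ᶜ), LinearMap.ker (LinearMap.proj (R := k) (φ := fun _ => k) i),
    ?_, ?_⟩
  · rw [(LinearMap.iInfKerProjEquiv k (fun _ : ι => k) (I := (↑I : Set ι)) (J := (↑I : Set ι)ᶜ)
      disjoint_compl_right (by simp)).finrank_eq, Module.finrank_fintype_fun_eq_card]
    simpa using hI
  · intro v hv
    simp only [Set.mem_compl_iff, Finset.mem_coe, Submodule.mem_iInf, LinearMap.mem_ker,
      LinearMap.proj_apply] at hv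
    rcases hS.eq_or_lt with rfl | hS'
    · simp
    rw [mul_comm, ← le_div_iff₀ hS', pi_norm_le_iff_of_nonneg (by positivity)]
    intro i
    by_cases hi : i ∈ I
    · rw [le_div_iff₀ hS']
      have := norm_le_pi_norm ((Matrix.diagonal d).mulVec v) i
      rw [Matrix.mulVec_diagonal, norm_mul] at this
      refine le_trans ?_ this
      rw [mul_comm]
      gcongr
      exact hd i hi
    · rw [hv i hi, norm_zero]
      positivity

theorem norm_det_le_of_entries {ι : Type*} [Fintype ι] [DecidableEq ι] {A : Matrix ι ι k} {C : ℝ}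
    (h : ∀ i j, ‖A i j‖ ≤ C) :
    ‖A.det‖ ≤ (Fintype.card ι).factorial • C ^ Fintype.card ι :=
  Matrix.det_le (abv := NormedField.toAbsoluteValue k) h

/-- The set of matrices in `SL_n` with entries bounded by `C`. -/
def boundedSL (ι k : Type*) [Fintype ι] [DecidableEq ι] [NormedField k] (C : ℝ) :
    Set (Matrix.SpecialLinearGroup ι k) :=
  {x | ∀ i j, ‖x.1 i j‖ ≤ C}

theorem isCompact_boundedSL {ι : Type*} [Fintype ι] [DecidableEq ι] [ProperSpace k] (C : ℝ) :
    IsCompact (boundedSL ι k C) := by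
  have h : IsCompact (Set.univ.pi fun _ : ι => Set.univ.pi fun _ : ι =>
      Metric.closedBall (0 : k) C) :=
    isCompact_univ_pi fun _ => isCompact_univ_pi fun _ => isCompact_closedBall _ _
  have h' := (Matrix.SpecialLinearGroup.isClosedEmbedding_val (n := ι) (R := k)).isCompact_preimage
    (K := Set.univ.pi fun _ : ι => Set.univ.pi fun _ : ι => Metric.closedBall (0 : k) C) h
  refine h'.of_isClosed_subset ?_ fun x hx i _ j _ => by simpa using hx i j
  simp only [boundedSL, Set.ofPred_forall]
  refine isClosed_iInter fun i => isClosed_iInter fun j => ?_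
  refine isClosed_le (Continuous.norm ?_) continuous_const
  exact (Matrix.SpecialLinearGroup.isClosedEmbedding_val (n := ι) (R := k)).continuous.matrix_elem
    i j

theorem finite_of_boundedSL [ProperSpace k] {m : ℕ}
    (Γ : Subgroup (Matrix.SpecialLinearGroup (Fin (m + 1)) k))
    [ProperlyDiscontinuousSMul Γ (Matrix.SpecialLinearGroup (Fin (m + 1)) k ⧸ slCorner m k)]
    (C : ℝ) :
    {γ : Γ | ∃ x ∈ boundedSL (Fin (m + 1)) k C, ∃ y ∈ boundedSL (Fin (m + 1)) k C,
      y⁻¹ * (γ.1 * x) ∈ slCorner m k}.Finite := by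
  have hK : IsCompact ((QuotientGroup.mk : _ → Matrix.SpecialLinearGroup (Fin (m + 1)) k ⧸
      slCorner m k) '' boundedSL (Fin (m + 1)) k C) :=
    (isCompact_boundedSL C).image QuotientGroup.continuous_mk
  refine (ProperlyDiscontinuousSMul.finite_disjoint_inter_image (Γ := Γ) hK hK).subset ?_
  rintro γ ⟨x, hx, y, hy, h⟩
  refine ⟨QuotientGroup.mk y, ⟨QuotientGroup.mk x, ⟨x, hx, rfl⟩, ?_⟩, ⟨y, hy, rfl⟩⟩
  exact (QuotientGroup.eq.2 h).symm

/-- Permuting columns and prescribing the last scale `z` spoils the determinant; rescaling column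
`0`, distinct from the last since `1 ≤ m`, repairs it at bounded cost. -/
theorem exists_boundedSL_of_swap {m : ℕ} (hm : 1 ≤ m) (C S : ℝ) (hC : 1 ≤ C) (hS : 1 ≤ S) :
    ∃ B, ∀ (N N' : Matrix (Fin (m + 1)) (Fin (m + 1)) k) (σ : Equiv.Perm (Fin (m + 1))) (z : k),
      N * N' = 1 → (∀ i j, ‖N i j‖ ≤ C) → (∀ i j, ‖N' i j‖ ≤ C) → ‖z‖ ≤ S → ‖z⁻¹‖ ≤ S → z ≠ 0 →
      ∃ x ∈ boundedSL (Fin (m + 1)) k B, ∃ e : Fin (m + 1) → k,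
        x.1 = N.submatrix id σ * Matrix.diagonal e ∧ e (Fin.last m) = z ∧ ∀ i, e i ≠ 0 := by
  set E := (Fintype.card (Fin (m + 1))).factorial • C ^ Fintype.card (Fin (m + 1)) with hE
  have hE0 : 0 ≤ E := by positivity
  refine ⟨C * (S + S * E + 1), fun N N' σ z hN hNC hNC' hz hz' hz0 => ?_⟩
  have h0 : (0 : Fin (m + 1)) ≠ Fin.last m := by
    rw [Ne, Fin.ext_iff]; simp; omega
  have hdet : N.det * N'.det = 1 := by rw [← Matrix.det_mul, hN, Matrix.det_one]
  have hNdet : N.det ≠ 0 := left_ne_zero_of_mul_eq_one hdet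
  have hinv : ‖N.det⁻¹‖ ≤ E := by
    rw [← eq_inv_of_mul_eq_one_right hdet]
    exact norm_det_le_of_entries hNC'
  set δ := (N.submatrix id σ).det with hδ
  rw [Matrix.det_permute'] at hδ
  have hsign : ‖((Equiv.Perm.sign σ : ℤ) : k)‖ = 1 := by
    rcases Int.units_eq_one_or (Equiv.Perm.sign σ) with h | h <;> simp [h]
  have hδ0 : δ ≠ 0 := by
    rw [hδ]
    refine mul_ne_zero ?_ hNdet
    rw [← norm_pos_iff, hsign]; exact one_pos
  have hδE : ‖δ⁻¹‖ ≤ E := by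
    rw [hδ, norm_inv, norm_mul, hsign, one_mul, ← norm_inv]
    exact hinv
  let e : Fin (m + 1) → k := Function.update (Function.update 1 0 (δ⁻¹ * z⁻¹)) (Fin.last m) z
  have hprod : ∏ i, e i = δ⁻¹ := by
    simp only [e]
    rw [Finset.prod_update_of_mem (Finset.mem_univ _), Finset.prod_update_of_mem (by simp [h0])]
    simp
    field_simp
  have hdet' : (N.submatrix id σ * Matrix.diagonal e).det = 1 := by
    rw [Matrix.det_mul, Matrix.det_diagonal, hprod]
    exact mul_inv_cancel₀ hδ0
  refine ⟨⟨_, hdet'⟩, fun i j => ?_, e, rfl, by simp [e], fun i => ?_⟩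
  · change ‖(N.submatrix id σ * Matrix.diagonal e) i j‖ ≤ _
    rw [Matrix.mul_diagonal, norm_mul]
    refine mul_le_mul (hNC _ _) ?_ (norm_nonneg _) (by linarith)
    have hSE : 0 ≤ S * E := by positivity
    rcases eq_or_ne j (Fin.last m) with rfl | hj
    · simp [e]; linarith
    rcases eq_or_ne j 0 with rfl | hj'
    · simp only [e, Function.update_of_ne hj, Function.update_self, norm_mul]
      have : ‖δ⁻¹‖ * ‖z⁻¹‖ ≤ E * S := mul_le_mul hδE hz' (norm_nonneg _) hE0
      linarith
    · simp only [e, Function.update_of_ne hj, Function.update_of_ne hj']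
      simp; linarith
  · rcases eq_or_ne i (Fin.last m) with rfl | hj
    · simpa [e] using hz0
    rcases eq_or_ne i 0 with rfl | hj'
    · simp only [e, Function.update_of_ne hj, Function.update_self]
      exact mul_ne_zero (inv_ne_zero hδ0) (inv_ne_zero hz0)
    · simp only [e, Function.update_of_ne hj, Function.update_of_ne hj']
      simp

theorem finite_not_expandsOnHalf [ProperSpace k] {m : ℕ} (hm : 1 ≤ m) (hodd : Odd (m + 1))
    (Γ : Subgroup (Matrix.SpecialLinearGroup (Fin (m + 1)) k))
    [ProperlyDiscontinuousSMul Γ (Matrix.SpecialLinearGroup (Fin (m + 1)) k ⧸ slCorner m k)]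
    (R : ℝ) :
    {γ : Γ | ¬ ExpandsOnHalf R γ.1.1 ∧ ¬ ExpandsOnHalf R (γ⁻¹).1.1}.Finite := by
  obtain ⟨C, hC, hdec⟩ := hasBoundedDiagonalization_fin (k := k) (m + 1)
  have hc : 0 < Fintype.card (Fin (m + 1)) * C := by
    have : 0 < Fintype.card (Fin (m + 1)) := Fintype.card_pos
    positivity
  set c := Fintype.card (Fin (m + 1)) * C with hc_def
  -- Expansion by `S` on the diagonal factor stays at least `R` after losing a factor `c` to each of
  -- the two outer matrices.
  set S := |R| * c * c + 1 with hS_def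
  have hS1 : 1 ≤ S := by
    have : 0 ≤ |R| * c * c := by positivity
    linarith
  have hS0 : 0 < S := by linarith
  have hSR : R ≤ S / c / c := by
    rw [le_div_iff₀ hc, le_div_iff₀ hc, hS_def]
    have : R * c * c ≤ |R| * c * c := by
      gcongr; exact le_abs_self R
    linarith
  obtain ⟨B, hB⟩ := exists_boundedSL_of_swap (k := k) hm C S hC hS1
  refine (finite_of_boundedSL Γ B).subset ?_
  rintro γ ⟨h1, h2⟩
  obtain ⟨P, P', Q, Q', d, hM, hP, hQ, b1, b2, b3, b4⟩ := hdec γ.1.1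
  have hP' : P' * P = 1 := mul_eq_one_comm.1 hP
  have hQ' : Q' * Q = 1 := mul_eq_one_comm.1 hQ
  have hd0 : ∀ i, d i ≠ 0 := by
    have := γ.1.2
    rw [hM, Matrix.det_mul, Matrix.det_mul, Matrix.det_diagonal] at this
    have h3 : ∏ i, d i ≠ 0 := by
      intro h; simp [h] at this
    intro i
    exact Finset.prod_ne_zero_iff.1 h3 i (Finset.mem_univ _)
  have hMinv : (γ⁻¹).1.1 = Q' * Matrix.diagonal d⁻¹ * P' := by
    have e1 : (γ⁻¹).1.1 * γ.1.1 = 1 := by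
      rw [← Matrix.SpecialLinearGroup.coe_mul, ← Subgroup.coe_mul, inv_mul_cancel]; simp
    have e2 : γ.1.1 * (Q' * Matrix.diagonal d⁻¹ * P') = 1 := by
      have e3 : Matrix.diagonal d * Matrix.diagonal d⁻¹ = 1 := by
        rw [Matrix.diagonal_mul_diagonal, ← Matrix.diagonal_one]
        congr 1; ext i; simp [hd0]
      calc γ.1.1 * (Q' * Matrix.diagonal d⁻¹ * P')
          = P * (Matrix.diagonal d * (Q * Q') * Matrix.diagonal d⁻¹) * P' := by
            rw [hM]; simp only [mul_assoc]
        _ = 1 := by rw [hQ, mul_one, e3, mul_one, hP]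
    exact left_inv_eq_right_inv e1 e2
  -- Otherwise each `d i` is large or has large inverse. As the size is odd, one of the two kinds is
  -- a strict majority, so `γ` or `γ⁻¹` expands.
  obtain ⟨i, hi1, hi2⟩ : ∃ i, ‖d i‖ ≤ S ∧ ‖(d i)⁻¹‖ ≤ S := by
    by_contra! hcon
    let I : Finset (Fin (m + 1)) := Finset.univ.filter fun i => S ≤ ‖d i‖
    by_cases hI : Fintype.card (Fin (m + 1)) < 2 * I.card
    · apply h1
      rw [hM]
      refine ExpandsOnHalf.mono (ExpandsOnHalf.mul_right (N' := Q') (ExpandsOnHalf.mul_left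
        (N' := P') (expandsOnHalf_diagonal hS0.le I hI fun i hi => (Finset.mem_filter.1 hi).2)
        hc hP' (norm_mulVec_le_of_entries b2)) (by positivity) hc hQ
        (norm_mulVec_le_of_entries b4)) hSR
    · apply h2
      rw [hMinv]
      have hI' : Fintype.card (Fin (m + 1)) < 2 * Iᶜ.card := by
        rw [Finset.card_compl]
        rw [Fintype.card_fin] at hI ⊢
        obtain ⟨l, hl⟩ := hodd
        omega
      refine ExpandsOnHalf.mono (ExpandsOnHalf.mul_right (N' := P) (ExpandsOnHalf.mul_left
        (N' := Q) (expandsOnHalf_diagonal hS0.le Iᶜ hI' fun i hi => ?_)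
        hc hQ (norm_mulVec_le_of_entries b3)) (by positivity) hc hP'
        (norm_mulVec_le_of_entries b1)) hSR
      have hi' : ‖d i‖ < S := by simpa [I] using hi
      exact (hcon i hi'.le).le
  -- `x` comes from `Q⁻¹` and `y` from `P`, with column `i` moved last and last scales `1` and `d
  -- i`. Then `y⁻¹ γ x` is diagonal with last entry `(d i)⁻¹ * d i = 1`.
  let σ := Equiv.swap i (Fin.last m)
  obtain ⟨x, hx, e, hxe, he, he0⟩ := hB Q' Q σ 1 hQ' b4 b3 (by simpa using hS1)
    (by simpa using hS1) one_ne_zero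
  obtain ⟨y, hy, f, hyf, hf, hf0⟩ := hB P P' σ (d i) hP b1 b2 hi1 hi2 (hd0 i)
  refine ⟨x, hx, y, hy, ?_⟩
  have key : (γ.1 * x).1 = y.1 * Matrix.diagonal fun j => (f j)⁻¹ * (d (σ j) * e j) := by
    have e1 : Q * Q'.submatrix id σ = (1 : Matrix _ _ k).submatrix id σ := by
      rw [← hQ]; rfl
    have e2 : P * (Matrix.diagonal d * (1 : Matrix _ _ k).submatrix id σ) =
        P.submatrix id σ * Matrix.diagonal (d ∘ σ) := by
      ext a b
      simp [Matrix.mul_apply, Matrix.diagonal, Matrix.one_apply]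
    rw [Matrix.SpecialLinearGroup.coe_mul, hxe, hyf, hM]
    calc P * Matrix.diagonal d * Q * (Q'.submatrix id σ * Matrix.diagonal e)
        = P * (Matrix.diagonal d * (Q * Q'.submatrix id σ)) * Matrix.diagonal e := by
          simp only [mul_assoc]
      _ = _ := by
          rw [e1, e2, mul_assoc, mul_assoc, Matrix.diagonal_mul_diagonal,
            Matrix.diagonal_mul_diagonal]
          congr 2
          ext j
          simp [mul_inv_cancel_left₀ (hf0 j)]
  refine mem_slCorner_of_diagonal (f := fun j => (f j)⁻¹ * (d (σ j) * e j)) ?_ ?_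
  · rw [Matrix.SpecialLinearGroup.coe_mul, key, ← mul_assoc,
      ← Matrix.SpecialLinearGroup.coe_mul, inv_mul_cancel]
    simp
  · simp [hf, he, σ, hd0]

theorem exists_norm_mulVec_le {ι : Type*} [Fintype ι] (M : Matrix ι ι k) :
    ∃ c : ℝ, 1 ≤ c ∧ ∀ v, ‖M.mulVec v‖ ≤ c * ‖v‖ := by
  obtain ⟨c, hc⟩ := (Set.finite_range fun q : ι × ι => ‖M q.1 q.2‖).bddAbove
  refine ⟨max 1 (Fintype.card ι * c), le_max_left _ _, fun v => (norm_mulVec_le_of_entries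
    (fun i j => hc ⟨(i, j), rfl⟩) v).trans ?_⟩
  gcongr
  exact le_max_right _ _

theorem finiteIndex_zpowers_of_properlyDiscontinuous [ProperSpace k] {m : ℕ} (hm : 1 ≤ m)
    (hodd : Odd (m + 1)) (Γ : Subgroup (Matrix.SpecialLinearGroup (Fin (m + 1)) k))
    [ProperlyDiscontinuousSMul Γ (Matrix.SpecialLinearGroup (Fin (m + 1)) k ⧸ slCorner m k)]
    (γ : Γ) (hγ : ¬ IsOfFinOrder γ) : (Subgroup.zpowers γ).FiniteIndex := by
  have hb : ∀ g : Γ, ∃ c : ℝ, 1 ≤ c ∧ ∀ v, ‖(g⁻¹).1.1.mulVec v‖ ≤ c * ‖v‖ :=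
    fun g => exists_norm_mulVec_le (g⁻¹).1.1
  have hinv : ∀ g : Γ, (g⁻¹).1.1 * g.1.1 = 1 := fun g => by
    rw [← Matrix.SpecialLinearGroup.coe_mul, ← Subgroup.coe_mul, inv_mul_cancel]; simp
  have hinv' : ∀ g : Γ, g.1.1 * (g⁻¹).1.1 = 1 := fun g => by
    rw [← Matrix.SpecialLinearGroup.coe_mul, ← Subgroup.coe_mul, mul_inv_cancel]; simp
  choose c hc hcb using hb
  let Big : ℝ → Γ → Prop := fun R g => ExpandsOnHalf R g.1.1
  have mono : ∀ R R' g, R ≤ R' → Big R' g → Big R g := fun R R' g h h' => h'.mono h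
  have left : ∀ R g h, 0 ≤ R → Big R g → Big (R / c h) (h * g) := fun R g h _ hg =>
    ExpandsOnHalf.mul_left hg (zero_lt_one.trans_le (hc h)) (hinv h) (hcb h)
  have right : ∀ R g h, 0 ≤ R → Big R g → Big (R / c h) (g * h) := fun R g h hR hg =>
    ExpandsOnHalf.mul_right hg hR (zero_lt_one.trans_le (hc h)) (hinv' h) (hcb h)
  have anti : ∀ R g, 1 < R → Big R g → ¬ Big R g⁻¹ := fun R g hR hg =>
    ExpandsOnHalf.not_inverse hg hR (hinv g)
  exact finiteIndex_zpowers_of_coarse_order Big c hc mono left right anti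
    (finite_not_expandsOnHalf hm hodd Γ) γ hγ

end ProperAction

/-! ### Torsion linear groups in characteristic zero -/

section TorsionLinear

variable {ι : Type*} [Fintype ι] [DecidableEq ι]

theorem pow_eq_one_of_mem_roots_charpoly {E : Type*} [Field E] {M : Matrix ι ι E} {d : ℕ}
    (hM : M ^ d = 1) {μ : E} (hμ : μ ∈ M.charpoly.roots) : μ ^ d = 1 := by
  have h := Matrix.mem_spectrum_of_isRoot_charpoly (Polynomial.isRoot_of_mem_roots hμ)
  have h' := spectrum.pow_mem_pow M d h
  rw [hM] at h'
  rcases isEmpty_or_nonempty ι with hι | hι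
  · exact absurd h' (by simp [spectrum.of_subsingleton])
  · simpa [spectrum.one_eq] using h'

theorem norm_trace_le_of_pow_eq_one {E : Type*} [NormedField E] [IsAlgClosed E] {M : Matrix ι ι E}
    {d : ℕ} (hd : d ≠ 0) (hM : M ^ d = 1) : ‖M.trace‖ ≤ Fintype.card ι := by
  rw [Matrix.trace_eq_sum_roots_charpoly]
  refine (norm_multiset_sum_le _).trans ?_
  have : (M.charpoly.roots.map fun x => ‖x‖).sum ≤
      Multiset.card (M.charpoly.roots.map fun x => ‖x‖) • (1 : ℝ) := by
    refine Multiset.sum_le_card_nsmul _ _ fun x hx => ?_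
    obtain ⟨μ, hμ, rfl⟩ := Multiset.mem_map.1 hx
    have h1 : ‖μ‖ ^ d = 1 := by
      rw [← norm_pow, pow_eq_one_of_mem_roots_charpoly hM hμ, norm_one]
    exact ((pow_eq_one_iff_of_nonneg (norm_nonneg _) hd).1 h1).le
  refine this.trans ?_
  rw [Multiset.card_map, nsmul_eq_mul, mul_one, Nat.cast_le]
  exact (Polynomial.card_roots' _).trans M.charpoly_natDegree_eq_dim.le

theorem isIntegral_trace_of_pow_eq_one {K : Type*} [Field K] {M : Matrix ι ι K}
    {d : ℕ} (hd : d ≠ 0) (hM : M ^ d = 1) : IsIntegral ℤ M.trace := by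
  let φ := algebraMap K (AlgebraicClosure K)
  suffices h : IsIntegral ℤ (φ M.trace) from
    (isIntegral_algHom_iff (φ.toIntAlgHom) φ.injective).1 h
  have hM' : (φ.mapMatrix M) ^ d = 1 := by rw [← map_pow, hM, map_one]
  have e : φ M.trace = (φ.mapMatrix M).trace := by
    simp [Matrix.trace]
  rw [e, Matrix.trace_eq_sum_roots_charpoly]
  refine Multiset.sum_induction _ _ (fun _ _ => IsIntegral.add) isIntegral_zero fun μ hμ => ?_
  refine IsIntegral.of_pow (Nat.pos_of_ne_zero hd) ?_
  rw [pow_eq_one_of_mem_roots_charpoly hM' hμ]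
  exact isIntegral_one

theorem matrix_eq_zero_of_isIdempotentElem_of_trace {K : Type*} [Field K] [CharZero K]
    {e : Matrix ι ι K} (he : IsIdempotentElem e) (ht : e.trace = 0) : e = 0 := by
  have h1 : IsIdempotentElem (Matrix.toLin' e) := by
    rw [IsIdempotentElem, Module.End.mul_eq_comp, ← Matrix.toLin'_mul, he.eq]
  have h2 := LinearMap.IsIdempotentElem.eq_zero_of_trace_eq_zero h1 (by rw [Matrix.trace_toLin'_eq, ht])
  exact (map_eq_zero_iff _ Matrix.toLin'.injective).1 h2

/-- The average of the powers of `M` is an idempotent fixed by `M`; the traces force it to have full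
rank. -/
theorem eq_one_of_trace_pow {K : Type*} [Field K] [CharZero K] {M : Matrix ι ι K} {d : ℕ}
    (hd : d ≠ 0) (hM : M ^ d = 1) (ht : ∀ j, (M ^ j).trace = Fintype.card ι) : M = 1 := by
  have hd' : (d : K) ≠ 0 := Nat.cast_ne_zero.2 hd
  set s := ∑ j ∈ Finset.range d, M ^ j with hs
  have hMs : M * s = s := by
    have := mul_geom_sum M d
    rw [hM, sub_self, sub_mul, one_mul, sub_eq_zero] at this
    exact this
  have hpow : ∀ j, M ^ j * s = s := fun j => by
    induction j with
    | zero => simp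
    | succ j ih => rw [pow_succ, mul_assoc, hMs, ih]
  have hss : s * s = (d : K) • s := by
    conv_lhs => rw [hs, Finset.sum_mul]
    rw [Finset.sum_congr rfl fun j _ => hpow j]
    simp [Nat.cast_smul_eq_nsmul]
  have he : IsIdempotentElem ((d : K)⁻¹ • s) := by
    rw [IsIdempotentElem, smul_mul_smul_comm, hss, smul_smul]
    congr 1
    field_simp
  have h0 := matrix_eq_zero_of_isIdempotentElem_of_trace he.one_sub (by
    rw [Matrix.trace_sub, Matrix.trace_one, Matrix.trace_smul, hs, Matrix.trace_sum,
      Finset.sum_congr rfl fun j _ => ht j]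
    simp [hd'])
  rw [sub_eq_zero] at h0
  rw [← mul_one M, h0, mul_smul_comm, hMs]

/-- An element is determined by its traces against a basis of the span of the group: if `g`, `h`
share these, all powers of `h⁻¹ * g` have the trace of the identity. -/
theorem finite_of_finite_trace {K : Type*} [Field K] [CharZero K] {G : Type*} [Group G]
    (hG : ∀ g : G, IsOfFinOrder g) (ρ : G →* Matrix ι ι K) (hρ : Function.Injective ρ)
    (hfin : (Set.range fun g => (ρ g).trace).Finite) : Finite G := by
  obtain ⟨b, hb, hspan, hli⟩ := exists_linearIndependent K (Set.range ρ)
  have hbfin : Finite b := hli.finite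
  choose r hr using fun x : b => hb x.2
  let F : G → b → Set.range fun g => (ρ g).trace := fun g x => ⟨(ρ (g * r x)).trace, g * r x, rfl⟩
  have := hfin.to_subtype
  refine Finite.of_injective F fun g h hgh => ?_
  have key : ∀ x ∈ Submodule.span K (Set.range ρ), ((ρ g - ρ h) * x).trace = 0 := by
    rw [← hspan]
    intro x hx
    induction hx using Submodule.span_induction with
    | mem x hx =>
      have := congrArg Subtype.val (congrFun hgh ⟨x, hx⟩)
      simp only [F, map_mul] at this
      rw [hr] at this
      rw [sub_mul, Matrix.trace_sub, this, sub_self]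
    | zero => simp
    | add x y _ _ hx hy => rw [mul_add, Matrix.trace_add, hx, hy, add_zero]
    | smul a x _ hx => rw [mul_smul_comm, Matrix.trace_smul, hx, smul_zero]
  have key' : ∀ a : G, (ρ (g * a)).trace = (ρ (h * a)).trace := fun a => by
    have := key (ρ a) (Submodule.subset_span ⟨a, rfl⟩)
    rwa [sub_mul, Matrix.trace_sub, sub_eq_zero, ← map_mul, ← map_mul] at this
  obtain ⟨d, hd, hd1⟩ := isOfFinOrder_iff_pow_eq_one.1 (hG (h⁻¹ * g))
  have h1 : ρ (h⁻¹ * g) = 1 := by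
    refine eq_one_of_trace_pow hd.ne' (by rw [← map_pow, hd1, map_one]) fun j => ?_
    rw [← map_pow]
    induction j with
    | zero => simp
    | succ j ih =>
      have := key' ((h⁻¹ * g) ^ j * h⁻¹)
      rw [← mul_assoc, map_mul, Matrix.trace_mul_comm, ← map_mul, ← mul_assoc, ← mul_assoc,
        ← pow_succ'] at this
      rw [this, mul_assoc, map_mul, Matrix.trace_mul_comm, ← map_mul, mul_assoc,
        inv_mul_cancel, mul_one, ih]
  rw [← map_one ρ] at h1
  exact (inv_mul_eq_one.1 (hρ h1)).symm

/-- `s * (M - 1) = 0` for `s` the sum of the powers of `M`, and `s` maps to `d • 1`, so `det s ≠ 0`.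
Hence specialization is faithful on torsion. -/
theorem eq_one_of_map_eq_one {B L : Type*} [CommRing B] [IsDomain B] [Field L] [CharZero L]
    (φ : B →+* L) {M : Matrix ι ι B} {d : ℕ} (hd : d ≠ 0) (hM : M ^ d = 1)
    (h : φ.mapMatrix M = 1) : M = 1 := by
  have h1 := geom_sum_mul M d
  rw [hM, sub_self] at h1
  set s := ∑ j ∈ Finset.range d, M ^ j with hs
  have h2 : φ.mapMatrix s = Matrix.diagonal fun _ => (d : L) := by
    rw [hs, map_sum]
    simp only [map_pow, h, one_pow, Finset.sum_const, Finset.card_range, nsmul_eq_mul, mul_one]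
    exact (Matrix.diagonal_natCast d).symm
  have hdet : s.det ≠ 0 := by
    intro h0
    have := φ.map_det s
    rw [h2, h0, map_zero, Matrix.det_diagonal] at this
    simp only [Finset.prod_const] at this
    exact pow_ne_zero _ (Nat.cast_ne_zero.2 hd) this.symm
  have h3 : s.adjugate * (s * (M - 1)) = s.det • (M - 1) := by
    rw [← mul_assoc, Matrix.adjugate_mul, Matrix.smul_mul, Matrix.one_mul]
  rw [h1, mul_zero] at h3
  exact sub_eq_zero.1 ((smul_eq_zero.1 h3.symm).resolve_left hdet)

theorem exists_ringHom_numberField.{u} (B : Type u) [CommRing B] [Nontrivial B] [Algebra ℚ B]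
    [Algebra.FiniteType ℚ B] :
    ∃ (L : Type u) (_ : Field L) (_ : NumberField L), Nonempty (B →+* L) := by
  obtain ⟨𝔪, h𝔪⟩ := Ideal.exists_maximal B
  let := Ideal.Quotient.field 𝔪
  have hfin : Module.Finite ℚ (B ⧸ 𝔪) := finite_of_finite_type_of_isJacobsonRing ℚ (B ⧸ 𝔪)
  have hchar : CharZero (B ⧸ 𝔪) := algebraRat.charZero _
  refine ⟨B ⧸ 𝔪, inferInstance, @NumberField.mk _ _ hchar ?_, ⟨Ideal.Quotient.mk 𝔪⟩⟩
  convert! hfin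
  exact Subsingleton.elim _ _

/-- Burnside–Schur: specialize the entries to a number field. The traces become algebraic integers
with all conjugates bounded by the matrix size, so only finitely many occur. -/
theorem finite_of_isTorsion_of_fg {K : Type*} [Field K] [CharZero K] {G : Type*} [Group G]
    [Group.FG G] (hG : ∀ g : G, IsOfFinOrder g) (ρ : G →* Matrix ι ι K) (hρ : Function.Injective ρ) :
    Finite G := by
  -- Generation as a monoid avoids adjoining the entries of inverses.
  obtain ⟨S, hS⟩ := (Monoid.fg_def.1 (Group.fg_iff_monoid_fg.1 ‹_›) : (⊤ : Submonoid G).FG)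
  let T : Set K := ⋃ s ∈ S, ⋃ i, ⋃ j, {ρ s i j}
  have hT : T.Finite := S.finite_toSet.biUnion fun s _ =>
    Set.finite_iUnion fun i => Set.finite_iUnion fun j => Set.finite_singleton _
  let B := Algebra.adjoin ℚ T
  have hBfg : Algebra.FiniteType ℚ B := by
    refine (Subalgebra.fg_iff_finiteType _).1 ?_
    have := Subalgebra.fg_adjoin_finset (R := ℚ) hT.toFinset
    rwa [hT.coe_toFinset] at this
  have hmem : ∀ g i j, ρ g i j ∈ B := by
    intro g
    have hg : g ∈ Submonoid.closure (S : Set G) := by rw [hS]; trivial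
    induction hg using Submonoid.closure_induction with
    | mem x hx =>
      intro i j
      refine Algebra.subset_adjoin ?_
      simp only [T, Set.mem_iUnion]
      exact ⟨x, hx, i, j, rfl⟩
    | one =>
      intro i j
      rw [map_one, Matrix.one_apply]
      split_ifs
      · exact B.one_mem
      · exact B.zero_mem
    | mul x y _ _ hx hy =>
      intro i j
      rw [map_mul, Matrix.mul_apply]
      exact B.sum_mem fun l _ => B.mul_mem (hx _ _) (hy _ _)
  let ρ' : G →* Matrix ι ι B :=
    { toFun := fun g => Matrix.of fun i j => ⟨ρ g i j, hmem g i j⟩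
      map_one' := by
        ext i j
        simp only [Matrix.of_apply, map_one, Matrix.one_apply]
        split_ifs <;> simp
      map_mul' := fun x y => by
        ext i j
        simp [Matrix.mul_apply] }
  have hρ' : Function.Injective ρ' := fun g h hgh => hρ <| by
    ext i j
    exact congrArg Subtype.val (congrFun (congrFun hgh i) j)
  obtain ⟨L, _, _, ⟨φ⟩⟩ := exists_ringHom_numberField B
  let ρ'' : G →* Matrix ι ι L := (φ.mapMatrix (m := ι)).toMonoidHom.comp ρ'
  refine finite_of_finite_trace hG ρ'' ?_ ?_
  · refine (injective_iff_map_eq_one _).2 fun g hg => ?_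
    obtain ⟨d, hd, hd1⟩ := isOfFinOrder_iff_pow_eq_one.1 (hG g)
    refine hρ' ?_
    rw [map_one]
    exact eq_one_of_map_eq_one φ hd.ne' (by rw [← map_pow, hd1, map_one]) hg
  · refine (NumberField.Embeddings.finite_of_norm_le L ℂ (Fintype.card ι)).subset ?_
    rintro _ ⟨g, rfl⟩
    obtain ⟨d, hd, hd1⟩ := isOfFinOrder_iff_pow_eq_one.1 (hG g)
    have h1 : (ρ'' g) ^ d = 1 := by rw [← map_pow, hd1, map_one]
    refine ⟨isIntegral_trace_of_pow_eq_one hd.ne' h1, fun τ => ?_⟩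
    have e : τ (ρ'' g).trace = (τ.mapMatrix (ρ'' g)).trace := by
      simp [Matrix.trace]
    rw [e]
    exact norm_trace_le_of_pow_eq_one hd.ne' (by rw [← map_pow, h1, map_one])

theorem eq_zero_of_trace_mul_eq_zero {K : Type*} [Field K] [CharZero K] {G : Type*} [Group G]
    [Finite G] (ρ : G →* Matrix ι ι K) {a : Matrix ι ι K}
    (ha : a ∈ Submodule.span K (Set.range ρ)) (h : ∀ g, (a * ρ g).trace = 0) : a = 0 := by
  have : NeZero (Nat.card G : K) := ⟨Nat.cast_ne_zero.2 Nat.card_pos.ne'⟩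
  let ψ := MonoidAlgebra.lift K (Matrix ι ι K) G ρ
  have hψ : ∀ g, ψ (MonoidAlgebra.of K G g) = ρ g := fun g => by simp [ψ]
  have hspan : ∀ y, ψ y ∈ Submodule.span K (Set.range ρ) := fun y => by
    induction y using MonoidAlgebra.induction_on with
    | of g => rw [hψ]; exact Submodule.subset_span ⟨g, rfl⟩
    | add x y hx hy => rw [map_add]; exact add_mem hx hy
    | smul r x hx => rw [map_smul]; exact Submodule.smul_mem _ _ hx
  obtain ⟨x, rfl⟩ : ∃ x, ψ x = a := by
    have : Submodule.span K (Set.range ρ) ≤ LinearMap.range ψ.toLinearMap := by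
      rw [Submodule.span_le]
      rintro _ ⟨g, rfl⟩
      exact ⟨_, hψ g⟩
    exact this ha
  -- The radical of the trace form is an ideal of a semisimple ring, so it is generated by an
  -- idempotent; that idempotent has trace zero, hence image zero.
  let N : Ideal (MonoidAlgebra K G) :=
    { carrier := {x | ∀ y, (ψ (x * y)).trace = 0}
      zero_mem' := by simp
      add_mem' := fun {x y} hx hy z => by
        rw [add_mul, map_add, Matrix.trace_add, hx, hy, add_zero]
      smul_mem' := fun c x hx z => by
        rw [smul_eq_mul, mul_assoc, map_mul, Matrix.trace_mul_comm, ← map_mul, mul_assoc, hx] }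
  obtain ⟨e, he, hN⟩ := IsSemisimpleRing.ideal_eq_span_idempotent N
  have heN : e ∈ N := by rw [hN]; exact Ideal.subset_span rfl
  have he0 : ψ e = 0 := matrix_eq_zero_of_isIdempotentElem_of_trace (he.map ψ)
    (by simpa using heN 1)
  have hx : x ∈ N := fun y => by
    rw [map_mul]
    have hy := hspan y
    generalize ψ y = z at hy
    induction hy using Submodule.span_induction with
    | mem z hz => obtain ⟨g, rfl⟩ := hz; exact h g
    | zero => simp
    | add u v _ _ hu hv => rw [mul_add, Matrix.trace_add, hu, hv, add_zero]
    | smul c u _ hu => rw [mul_smul_comm, Matrix.trace_smul, hu, smul_zero]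
  rw [hN, Ideal.mem_span_singleton'] at hx
  obtain ⟨c, rfl⟩ := hx
  rw [map_mul, he0, mul_zero]

theorem exists_bound_of_isTorsion {k E : Type*} [NormedField k] [CharZero k] [NormedField E]
    [IsAlgClosed E] (τ : k →+* E) (hτ : ∀ x, ‖τ x‖ = ‖x‖) {G : Type*} [Group G]
    (hG : ∀ g : G, IsOfFinOrder g) (ρ : G →* Matrix ι ι k) (hρ : Function.Injective ρ) :
    ∃ C : ℝ, ∀ g i j, ‖ρ g i j‖ ≤ C := by
  have htr : ∀ g, ‖(ρ g).trace‖ ≤ Fintype.card ι := fun g => by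
    obtain ⟨d, hd, hd1⟩ := isOfFinOrder_iff_pow_eq_one.1 (hG g)
    have h1 : (ρ g) ^ d = 1 := by rw [← map_pow, hd1, map_one]
    have e : τ (ρ g).trace = (τ.mapMatrix (ρ g)).trace := by
      simp [Matrix.trace]
    rw [← hτ, e]
    exact norm_trace_le_of_pow_eq_one hd.ne' (by rw [← map_pow, h1, map_one])
  obtain ⟨b, hb, hspan, hli⟩ := exists_linearIndependent k (Set.range ρ)
  have hbfin : b.Finite := hli.setFinite
  obtain ⟨T, rfl⟩ := Set.subset_range_iff_exists_image_eq.1 hb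
  have hTfin : T.Finite := Set.Finite.of_finite_image hbfin hρ.injOn
  let H := Subgroup.closure T
  have : Finite T := hTfin
  have hHfg : Group.FG H := Group.closure_finite_fg T
  let ρH : H →* Matrix ι ι k := ρ.comp H.subtype
  have hHfin : Finite H := finite_of_isTorsion_of_fg
    (fun h => Submonoid.isOfFinOrder_coe.1 (hG h.1)) ρH (hρ.comp H.subtype_injective)
  have : Fintype H := Fintype.ofFinite H
  classical
  let W := Submodule.span k (Set.range ρH)
  have hW : ∀ g, ρ g ∈ W := fun g => by
    have h1 : ρ g ∈ Submodule.span k (ρ '' T) := by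
      rw [hspan]; exact Submodule.subset_span ⟨g, rfl⟩
    refine Submodule.span_mono ?_ h1
    rintro _ ⟨t, ht, rfl⟩
    exact ⟨⟨t, Subgroup.subset_closure ht⟩, rfl⟩
  -- Injective by nondegeneracy of the trace form, so a left inverse bounds the entries of `ρ g` by
  -- the bounded traces of `ρ (g * h)`.
  let Tr : W →ₗ[k] (H → k) := LinearMap.pi fun h =>
    (Matrix.traceLinearMap ι k k).comp ((LinearMap.mulRight k (ρH h)).comp W.subtype)
  have hTr : ∀ (w : W) h, Tr w h = (w.1 * ρH h).trace := fun w h => rfl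
  obtain ⟨L, hL⟩ := LinearMap.exists_leftInverse_of_injective Tr (by
    rw [LinearMap.ker_eq_bot']
    intro w hw
    exact Subtype.ext (eq_zero_of_trace_mul_eq_zero ρH w.2 fun h => congrFun hw h))
  have key : ∀ g i j, ‖ρ g i j‖ ≤ ∑ h : H, Fintype.card ι * ‖(L (fun l => if h = l then 1 else 0)).1 i j‖ := by
    intro g i j
    have h1 : L (Tr ⟨ρ g, hW g⟩) = ⟨ρ g, hW g⟩ := LinearMap.congr_fun hL _
    rw [LinearMap.pi_apply_eq_sum_univ L] at h1
    have h2 := congrArg (fun w : W => w.1 i j) h1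
    simp only [Submodule.coe_sum, Matrix.sum_apply, Submodule.coe_smul, Matrix.smul_apply] at h2
    rw [← h2]
    refine norm_sum_le_of_le _ fun h _ => ?_
    rw [smul_eq_mul, norm_mul, hTr]
    have h3 : ‖(ρ g * ρH h).trace‖ ≤ Fintype.card ι := by
      have := htr (g * h)
      rwa [map_mul] at this
    exact mul_le_mul_of_nonneg_right h3 (norm_nonneg _)
  obtain ⟨C, hC⟩ := (Set.finite_range fun q : ι × ι =>
    ∑ h : H, Fintype.card ι * ‖(L (fun l => if h = l then 1 else 0)).1 q.1 q.2‖).bddAbove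
  exact ⟨C, fun g i j => (key g i j).trans (hC ⟨(i, j), rfl⟩)⟩

end TorsionLinear

/-! ### Local fields and the conclusion -/

section Main

theorem isVirtuallyCyclic_of_properlyDiscontinuous {k E : Type*} [NormedField k] [ProperSpace k]
    [CharZero k] [NormedField E] [IsAlgClosed E] (τ : k →+* E) (hτ : ∀ x, ‖τ x‖ = ‖x‖) {m : ℕ}
    (hm : 1 ≤ m) (hodd : Odd (m + 1)) (Γ : Subgroup (Matrix.SpecialLinearGroup (Fin (m + 1)) k))
    [ProperlyDiscontinuousSMul Γ (Matrix.SpecialLinearGroup (Fin (m + 1)) k ⧸ slCorner m k)] :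
    IsVirtuallyCyclic Γ := by
  by_cases h : ∃ γ : Γ, ¬ IsOfFinOrder γ
  · obtain ⟨γ, hγ⟩ := h
    exact ⟨Subgroup.zpowers γ, finiteIndex_zpowers_of_properlyDiscontinuous hm hodd Γ γ hγ,
      inferInstance⟩
  · push Not at h
    let ρ : Γ →* Matrix (Fin (m + 1)) (Fin (m + 1)) k :=
      { toFun := fun g => g.1.1
        map_one' := rfl
        map_mul' := fun _ _ => rfl }
    have hρ : Function.Injective ρ := fun g h hgh => Subtype.ext (Subtype.ext hgh)
    obtain ⟨C, hC⟩ := exists_bound_of_isTorsion τ hτ h ρ hρ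
    have hfin : Finite Γ := by
      -- Each `γ` moves the base point `1` to `γ`, and both representatives are bounded.
      refine Set.finite_univ_iff.1 ((finite_of_boundedSL Γ (max C 1)).subset fun γ _ => ?_)
      refine ⟨1, fun i j => ?_, γ.1, fun i j => (hC γ i j).trans (le_max_left _ _), ?_⟩
      · refine le_trans ?_ (le_max_right C 1)
        rw [Matrix.SpecialLinearGroup.coe_one, Matrix.one_apply]
        split_ifs <;> simp
      · rw [mul_one, inv_mul_cancel]
        exact one_mem _
    exact ⟨⊥, inferInstance, inferInstance⟩

theorem Homeomorph.isCompact_preimage_closedBall {X F E : Type*} [TopologicalSpace X]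
    [SeminormedAddCommGroup F] [ProperSpace F] [SeminormedAddCommGroup E] (h : X ≃ₜ F) (f : X → E)
    (hf : ∀ x, ‖f x‖ = ‖h x‖) (r : ℝ) : IsCompact (f ⁻¹' Metric.closedBall 0 r) := by
  have e : f ⁻¹' Metric.closedBall 0 r = h ⁻¹' Metric.closedBall 0 r := by
    ext x
    simp [hf]
  rw [e, h.isCompact_preimage]
  exact isCompact_closedBall _ _

/-- A local field of characteristic zero embeds into an algebraically closed normed field in such
a way that its topology is induced by the norm, with compact balls. -/
theorem IsCharZeroLocalField.exists_embedding {k : Type*} [Field k] [t : TopologicalSpace k]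
    (hk : IsCharZeroLocalField k) : CharZero k ∧
    ∃ (E : Type) (_ : NormedField E) (_ : IsAlgClosed E) (τ : k →+* E),
      t = TopologicalSpace.induced τ inferInstance ∧
      ∀ r : ℝ, IsCompact (τ ⁻¹' Metric.closedBall 0 r) := by
  rcases hk with ⟨e, he⟩ | ⟨e, he⟩ | ⟨p, _, _, hfin, hmod⟩
  · refine ⟨charZero_of_injective_ringHom (f := e.toRingHom) e.injective, ℂ, inferInstance, inferInstance,
      Complex.ofRealHom.comp (e.symm : k →+* ℝ), ?_, ?_⟩
    all_goals
      let h : k ≃ₜ ℝ := { toEquiv := e.symm.toEquiv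
                          continuous_toFun := e.toEquiv.continuous_symm_iff.2 he.isOpenMap
                          continuous_invFun := he.continuous }
    · exact (Complex.isometry_ofReal.isEmbedding.isInducing.comp h.isInducing).eq_induced
    · exact h.isCompact_preimage_closedBall _ fun x => Complex.norm_real _
  · refine ⟨charZero_of_injective_ringHom (f := e.toRingHom) e.injective, ℂ, inferInstance,
      inferInstance, (e.symm : k →+* ℂ), ?_, ?_⟩
    all_goals
      let h : k ≃ₜ ℂ := { toEquiv := e.symm.toEquiv
                          continuous_toFun := e.toEquiv.continuous_symm_iff.2 he.isOpenMap
                          continuous_invFun := he.continuous }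
    · exact h.isInducing.eq_induced
    · exact h.isCompact_preimage_closedBall _ fun x => rfl
  · have hchar : CharZero k := charZero_of_injective_algebraMap (algebraMap ℚ_[p] k).injective
    have : Algebra.IsAlgebraic ℚ_[p] k := Algebra.IsAlgebraic.of_finite ℚ_[p] k
    let τ : k →ₐ[ℚ_[p]] PadicAlgCl p := IsAlgClosed.lift
    let V := LinearMap.range τ.toLinearMap
    have hV : FiniteDimensional ℚ_[p] V := inferInstance
    let e : k ≃ₗ[ℚ_[p]] V := LinearEquiv.ofInjective τ.toLinearMap τ.toRingHom.injective
    have : IsModuleTopology ℚ_[p] V := isModuleTopologyOfFiniteDimensional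
    have : ProperSpace V := FiniteDimensional.proper ℚ_[p] V
    -- Both sides carry the module topology, so linear maps in either direction are continuous.
    have he : Continuous e := IsModuleTopology.continuous_of_linearMap e.toLinearMap
    have : ContinuousAdd k := IsModuleTopology.toContinuousAdd ℚ_[p] k
    have he' : Continuous e.symm := IsModuleTopology.continuous_of_linearMap e.symm.toLinearMap
    let h : k ≃ₜ V := { toEquiv := e.toEquiv, continuous_toFun := he, continuous_invFun := he' }
    exact ⟨hchar, PadicAlgCl p, inferInstance, inferInstance, τ,
      (Topology.IsInducing.subtypeVal.comp h.isInducing).eq_induced,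
      h.isCompact_preimage_closedBall _ fun x => rfl⟩

theorem corollary1p4 {k : Type*} [Field k] [TopologicalSpace k] (hk : IsCharZeroLocalField k)
    (m : ℕ) (hm : 3 ≤ m + 1) (hodd : Odd (m + 1))
    (Γ : Subgroup (Matrix.SpecialLinearGroup (Fin (m + 1)) k))
    (hdisc : DiscreteTopology Γ)
    (hpd : ProperlyDiscontinuousSMul Γ
      (Matrix.SpecialLinearGroup (Fin (m + 1)) k ⧸ slCorner m k)) :
    IsVirtuallyAbelian Γ ∧ IsVirtuallyCyclic Γ := by
  have key : IsVirtuallyCyclic Γ := by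
    obtain ⟨hchar, E, _, _, τ, rfl, hcpt⟩ := hk.exists_embedding
    -- The given topology has been replaced by the one induced by `τ`, so this norm introduces no
    -- second topology.
    let : NormedField k := NormedField.induced k E τ τ.injective
    have : ProperSpace k := by
      refine ProperSpace.of_seq_closedBall (x := (0 : k)) Filter.tendsto_id
        (Filter.Eventually.of_forall fun r => ?_)
      have : Metric.closedBall (0 : k) r = τ ⁻¹' Metric.closedBall 0 r := by
        ext x
        rw [Set.mem_preimage, mem_closedBall_zero_iff, mem_closedBall_zero_iff]
        rfl
      exact this ▸ hcpt r
    exact isVirtuallyCyclic_of_properlyDiscontinuous τ (fun _ => rfl) (by omega) hodd Γ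
  refine ⟨?_, key⟩
  obtain ⟨C, hC, hcyc⟩ := key
  refine ⟨C, hC, fun x hx y hy => ?_⟩
  have := hcyc.commGroup.mul_comm ⟨x, hx⟩ ⟨y, hy⟩
  exact congrArg Subtype.val this

end Main
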